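/- For each $n\in\mathbb N$ let $X_n$ be a standard Borel space, $T_n:X_n\to X_n$ an invertible bi-measurable map, and $\mu_n\sim\nu_n$ equivalent probability measures on $X_n$ such that $(X_n,\nu_n,T_n)$ is mildly mixing: $T_n$ preserves $\nu_n$, is ergodic, and every $f\in L^\infty(\nu_n)$ with $\|f\circ T_n^{k_i}-f\|_{L^1(\nu_n)}\to0$ for some sequence $k_i\to\infty$ is constant a.e. Put $\phi_n=\frac{d\mu_n}{d\nu_n}$, $X=\prod_n X_n$, $\mu=\bigotimes_n\mu_n$, $\nu=\bigotimes_n\nu_n$, and let $T:X\to X$ act by $T(x_n)_n=(T_nx_n)_n$. Suppose that $$\prod_{n=1}^\infty\int_{X_n}\sqrt{\phi_n\cdot\phi_n\circ T_n^{-1}}\,d\nu_n>0\qquad\text{and}\qquad \prod_{n=1}^\infty\int_{X_n}\sqrt{\phi_n}\,d\nu_n=0,$$ and that $T$ is $\mu$-conservative. Then $T$ is $\mu$-sharply weak mixing, and $\mu\perp\nu$. Here an invertible bi-measurable map $R$ of a standard Borel space with a $\sigma$-finite measure $m$ is nonsingular if $m\circ R^{-1}\sim m$; ergodic if every $R$-invariant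 measurable set is $m$-null or $m$-conull; a measurable set $W$ is wandering if the sets $R^nW$, $n\in\mathbb Z$, are pairwise disjoint; $R$ is conservative if every wandering set is $m$-null, and totally dissipative if $\bigcup_{n\in\mathbb Z}R^nW$ is $m$-conull for some wandering set $W$. An ergodic conservative nonsingular $R$ is sharply weak mixing if for each ergodic conservative nonsingular transformation $S$ of a standard Borel space with a $\sigma$-finite measure, the direct product $R\times S$ is either totally dissipative or ergodic with respect to the product measure. -/

import Mathlib

open MeasureTheory Filter Topology
open scoped ENNReal

universe u v

/-- An invertible bi-measurable map `T` is nonsingular for `μ` if the image of `μ` under `T`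
has the same null sets as `μ`. -/
def IsNonsingular {X : Type u} [MeasurableSpace X] (T : X ≃ᵐ X) (μ : Measure X) : Prop :=
  μ.map T ≪ μ ∧ μ ≪ μ.map T

/-- A wandering set: a measurable set whose images `T ^ n W`, for `n : ℤ`, are pairwise disjoint. -/
def IsWandering {X : Type u} [MeasurableSpace X] (T : X ≃ᵐ X) (W : Set X) : Prop :=
  MeasurableSet W ∧
    Pairwise fun m n : ℤ =>
      Disjoint (((T.toEquiv : Equiv.Perm X) ^ m) '' W) (((T.toEquiv : Equiv.Perm X) ^ n) '' W)

/-- `T` is conservative for `μ`: there is no wandering set of positive measure, that is, the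
dissipative part of the Hopf decomposition is null. -/
def IsConservative {X : Type u} [MeasurableSpace X] (T : X ≃ᵐ X) (μ : Measure X) : Prop :=
  ∀ W : Set X, IsWandering T W → μ W = 0

/-- `T` is totally dissipative for `μ`: up to a null set, the space is the disjoint union of the
images `T ^ n W`, for `n : ℤ`, of one wandering set `W`. -/
def IsTotallyDissipative {X : Type u} [MeasurableSpace X] (T : X ≃ᵐ X) (μ : Measure X) : Prop :=
  ∃ W : Set X, IsWandering T W ∧ μ (⋃ n : ℤ, ((T.toEquiv : Equiv.Perm X) ^ n) '' W)ᶜ = 0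

/-- `T` is mildly mixing for the probability measure `ν`: it is an ergodic `ν`-preserving
transformation, and every `f ∈ L^∞(ν)` such that `‖f ∘ T ^ (k i) - f‖₁ → 0` for some sequence
`k i → ∞` is constant almost everywhere. -/
structure IsMildlyMixing {X : Type u} [MeasurableSpace X] (T : X ≃ᵐ X) (ν : Measure X) :
    Prop where
  ergodic : Ergodic T ν
  rigid_const : ∀ f : X → ℝ, MemLp f ∞ ν → ∀ k : ℕ → ℕ, Tendsto k atTop atTop →
    Tendsto (fun i => eLpNorm (fun x => f (T^[k i] x) - f x) 1 ν) atTop (𝓝 0) →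
      ∃ c : ℝ, ∀ᵐ x ∂ν, f x = c

/-- `R` is an ergodic conservative nonsingular transformation. (`PreErgodic` says that every
invariant measurable set is null or conull.) -/
structure IsErgodicConservative {X : Type u} [MeasurableSpace X] (R : X ≃ᵐ X) (μ : Measure X) :
    Prop where
  nonsingular : IsNonsingular R μ
  ergodic : PreErgodic R μ
  conservative : IsConservative R μ

/-- `R` is sharply weak mixing for `μ`: it is ergodic, conservative and nonsingular, and for each
ergodic conservative nonsingular transformation `S` of a standard measure space, the direct
product `R × S` is either totally dissipative or ergodic. -/
structure IsSharplyWeakMixing {X : Type u} [MeasurableSpace X] (R : X ≃ᵐ X) (μ : Measure X) :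
    Prop where
  ergodicConservative : IsErgodicConservative R μ
  prod_ergodic : ∀ (Y : Type v) [MeasurableSpace Y] [StandardBorelSpace Y]
    (κ : Measure Y) [SigmaFinite κ] (S : Y ≃ᵐ Y), IsErgodicConservative S κ →
      IsTotallyDissipative (R.prodCongr S) (μ.prod κ) ∨
        PreErgodic (R.prodCongr S) (μ.prod κ)

/-- The direct product of a sequence of transformations, acting coordinatewise. -/
def productMap {X : ℕ → Type u} [∀ n, MeasurableSpace (X n)] (T : ∀ n, X n ≃ᵐ X n) :
    (∀ n, X n) ≃ᵐ (∀ n, X n) :=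
  MeasurableEquiv.piCongrRight T

/-- The Radon-Nikodym derivative `dμ/dν` as a real function. -/
noncomputable def density {X : Type u} [MeasurableSpace X] (μ ν : Measure X) : X → ℝ :=
  fun x => (μ.rnDeriv ν x).toReal

/-! The product structure is exploited by resampling one coordinate. Replacing the `n`-th coordinate
of `x` by `t` defines a factor map `(t, x, y) ↦ (x with t at n, y)` from `T_n × (T × S)` onto `T ×
S`. It carries `μ_n ⊗ μ ⊗ κ` to `μ ⊗ κ`, and on the extra coordinate `μ_n` may be traded for `ν_n`,
which `T_n` preserves and for which it is mildly mixing.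

If `T × S` is conservative, an invariant set `A` pulls back to an invariant set of `T_n × (T × S)`.
Recurrence of its sections makes almost every section along `t` rigid, and mild mixing makes it null
or conull (`IsMildlyMixing.ae_section_null_or_conull`). So `A` depends on no coordinate `n`; by the
zero-one law it is `X × B` up to a null set, and ergodicity of `S` settles `B`.

The same argument shows that `T × S` is either totally dissipative or conservative. Let `D` be its
dissipative part, the saturation of a maximal wandering set. Over the complement of `D` the product
with the measure-preserving `T_n` is still conservative (`IsWandering.measure_prod_eq_zero`), so
resampling cannot lead from outside `D` into `D`. Hence `D` too depends on no coordinate, and is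
null or conull.

Nonsingularity of `T` and `μ ⊥ ν` are the two cases of Kakutani's theorem: the first product is that
of the affinities of `μ_n` and its image under `T_n`, the second that of the affinities of `μ_n` and
`ν_n`. -/

/-! ### Wandering sets and the Hopf decomposition. -/

section Wandering

variable {X : Type u} [MeasurableSpace X]

/-- The integer iterates of an invertible bi-measurable map. -/
def zpowMap (T : X ≃ᵐ X) (n : ℤ) : X → X := ((T.toEquiv : Equiv.Perm X) ^ n : Equiv.Perm X)

theorem zpowMap_natCast (T : X ≃ᵐ X) (n : ℕ) : zpowMap T n = T^[n] := by
  unfold zpowMap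
  rw [zpow_natCast, Equiv.Perm.coe_pow]
  rfl

theorem zpowMap_add (T : X ≃ᵐ X) (m n : ℤ) (x : X) :
    zpowMap T (m + n) x = zpowMap T m (zpowMap T n x) := by
  simp only [zpowMap, zpow_add, Equiv.Perm.mul_apply]

theorem zpowMap_zero (T : X ≃ᵐ X) (x : X) : zpowMap T 0 x = x := by
  simp [zpowMap]

theorem zpowMap_one (T : X ≃ᵐ X) (x : X) : zpowMap T 1 x = T x := by
  simp [zpowMap]

theorem zpowMap_neg_natCast (T : X ≃ᵐ X) (n : ℕ) : zpowMap T (-n) = T.symm^[n] := by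
  unfold zpowMap
  rw [zpow_neg, zpow_natCast, ← inv_pow, Equiv.Perm.coe_pow]
  rfl

theorem measurable_zpowMap (T : X ≃ᵐ X) (n : ℤ) : Measurable (zpowMap T n) := by
  obtain ⟨k, rfl | rfl⟩ := n.eq_nat_or_neg
  · rw [zpowMap_natCast]
    exact T.measurable.iterate k
  · rw [zpowMap_neg_natCast]
    exact T.symm.measurable.iterate k

theorem image_zpow_eq_preimage (T : X ≃ᵐ X) (n : ℤ) (W : Set X) :
    ((T.toEquiv : Equiv.Perm X) ^ n) '' W = zpowMap T (-n) ⁻¹' W := by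
  ext x
  constructor
  · rintro ⟨w, hw, rfl⟩
    change zpowMap T (-n) (zpowMap T n w) ∈ W
    rwa [← zpowMap_add, neg_add_cancel, zpowMap_zero]
  · intro hx
    refine ⟨zpowMap T (-n) x, hx, ?_⟩
    change zpowMap T n (zpowMap T (-n) x) = x
    rw [← zpowMap_add, add_neg_cancel, zpowMap_zero]

theorem isWandering_iff_zpow (T : X ≃ᵐ X) (W : Set X) :
    IsWandering T W ↔ MeasurableSet W ∧ ∀ n : ℤ, n ≠ 0 → ∀ x ∈ W, zpowMap T n x ∉ W := by
  refine and_congr_right fun _ => ⟨fun h n hn x hx hx' => ?_, fun h m n hmn => ?_⟩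
  · exact Set.disjoint_left.1 (h hn) (Set.mem_image_of_mem _ hx) ⟨_, hx', by simp; rfl⟩
  · dsimp only
    rw [image_zpow_eq_preimage, image_zpow_eq_preimage]
    refine Set.disjoint_left.2 fun x hm hn => h (m - n) (sub_ne_zero.2 hmn) _ hm ?_
    rw [← zpowMap_add, show m - n + -m = -n by ring]
    exact hn

/-- Forward times suffice: a return of `x` at time `-n` is a return at time `n` of the point
reached. -/
theorem isWandering_iff (T : X ≃ᵐ X) (W : Set X) :
    IsWandering T W ↔ MeasurableSet W ∧ ∀ x ∈ W, ∀ n : ℕ, n ≠ 0 → T^[n] x ∉ W := by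
  rw [isWandering_iff_zpow]
  refine and_congr_right fun _ => ⟨fun h x hx n hn => ?_, fun h n hn x hx hx' => ?_⟩
  · rw [← zpowMap_natCast]
    exact h n (by exact_mod_cast hn) x hx
  · obtain ⟨k, rfl | rfl⟩ := n.eq_nat_or_neg
    · rw [zpowMap_natCast] at hx'
      exact h x hx k (by simpa using hn) hx'
    · refine h _ hx' k (by simpa using hn) ?_
      rwa [← zpowMap_natCast, ← zpowMap_add, add_neg_cancel, zpowMap_zero]

/-- The union of all the images of a set under the integer iterates of a map. -/
def saturation (T : X ≃ᵐ X) (W : Set X) : Set X := {x | ∃ n : ℤ, zpowMap T n x ∈ W}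

theorem iUnion_image_zpow (T : X ≃ᵐ X) (W : Set X) :
    (⋃ n : ℤ, ((T.toEquiv : Equiv.Perm X) ^ n) '' W) = saturation T W := by
  ext x
  simp only [image_zpow_eq_preimage, Set.mem_iUnion, Set.mem_preimage, saturation,
    Set.mem_ofPred_eq]
  exact ⟨fun ⟨n, h⟩ => ⟨-n, h⟩, fun ⟨n, h⟩ => ⟨-n, by rwa [neg_neg]⟩⟩

theorem measurableSet_saturation (T : X ≃ᵐ X) {W : Set X} (hW : MeasurableSet W) :
    MeasurableSet (saturation T W) := by
  rw [← iUnion_image_zpow]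
  simp only [image_zpow_eq_preimage]
  exact .iUnion fun n => measurable_zpowMap T _ hW

theorem subset_saturation (T : X ≃ᵐ X) (W : Set X) : W ⊆ saturation T W :=
  fun x hx => ⟨0, by rwa [zpowMap_zero]⟩

theorem zpowMap_mem_saturation_iff (T : X ≃ᵐ X) (W : Set X) (n : ℤ) (x : X) :
    zpowMap T n x ∈ saturation T W ↔ x ∈ saturation T W := by
  constructor
  · rintro ⟨m, hm⟩
    exact ⟨m + n, by rwa [zpowMap_add]⟩
  · rintro ⟨m, hm⟩
    exact ⟨m - n, by rwa [← zpowMap_add, sub_add_cancel]⟩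

theorem apply_mem_saturation_iff (T : X ≃ᵐ X) (W : Set X) (x : X) :
    T x ∈ saturation T W ↔ x ∈ saturation T W := by
  rw [← zpowMap_one, zpowMap_mem_saturation_iff]

theorem IsWandering.preimage_zpowMap {T : X ≃ᵐ X} {W : Set X} (h : IsWandering T W) (n : ℤ) :
    IsWandering T (zpowMap T n ⁻¹' W) := by
  rw [isWandering_iff_zpow] at h ⊢
  refine ⟨measurable_zpowMap T n h.1, fun m hm x hx hx' => h.2 m hm _ hx ?_⟩
  rw [Set.mem_preimage, ← zpowMap_add] at hx'
  rwa [← zpowMap_add, add_comm]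

/-- Countably many wandering sets can be replaced by a single one with the same saturation. -/
theorem exists_isWandering_saturation_eq_iUnion {T : X ≃ᵐ X} {W : ℕ → Set X}
    (hW : ∀ k, IsWandering T (W k)) :
    ∃ V, IsWandering T V ∧ saturation T V = ⋃ k, saturation T (W k) := by
  -- Each orbit is assigned to the least `k` whose `W k` it meets. Saturations are invariant, so an
  -- orbit cannot meet two different pieces.
  refine ⟨⋃ k, W k \ ⋃ j < k, saturation T (W j), ?_, ?_⟩
  · rw [isWandering_iff_zpow]
    refine ⟨.iUnion fun k => (hW k).1.diff <| .biUnion (Set.to_countable _) fun j _ =>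
      measurableSet_saturation T (hW j).1, fun n hn x hx hx' => ?_⟩
    simp only [Set.mem_iUnion, Set.mem_sdiff, not_exists, zpowMap_mem_saturation_iff] at hx hx'
    obtain ⟨k, hk, hk'⟩ := hx
    obtain ⟨j, hj, hj'⟩ := hx'
    rcases lt_trichotomy j k with h | rfl | h
    · exact hk' j h ⟨n, hj⟩
    · exact ((isWandering_iff_zpow _ _).1 (hW j)).2 n hn x hk hj
    · exact hj' k h (subset_saturation T _ hk)
  · classical
    ext x
    constructor
    · rintro ⟨n, hn⟩
      obtain ⟨k, hk⟩ := Set.mem_iUnion.1 hn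
      exact Set.mem_iUnion.2 ⟨k, n, hk.1⟩
    · intro hx
      have hx : ∃ k, x ∈ saturation T (W k) := Set.mem_iUnion.1 hx
      obtain ⟨n, hn⟩ := Nat.find_spec hx
      refine ⟨n, Set.mem_iUnion.2 ⟨Nat.find hx, hn, ?_⟩⟩
      simp only [Set.mem_iUnion, not_exists, zpowMap_mem_saturation_iff]
      exact fun j hj => Nat.find_min hx hj

/-- **Hopf decomposition**: some wandering set absorbs, up to null sets and after saturation,
all the wandering sets. -/
theorem exists_isWandering_maximal (T : X ≃ᵐ X) (μ : Measure X) [SFinite μ] :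
    ∃ W, IsWandering T W ∧ ∀ V, IsWandering T V → μ (V \ saturation T W) = 0 := by
  -- A finite measure with the same null sets makes the supremum below finite and allows
  -- subtraction.
  set m := μ.toFinite
  obtain ⟨s, -, hs, hsW⟩ := exists_seq_tendsto_sSup
    (S := {c | ∃ W, IsWandering T W ∧ m (saturation T W) = c})
    ⟨_, ∅, ⟨.empty, fun _ _ _ => by simp⟩, rfl⟩ (OrderTop.bddAbove _)
  choose W hW hWs using hsW
  obtain ⟨V, hV, hVW⟩ := exists_isWandering_saturation_eq_iUnion hW
  refine ⟨V, hV, fun U hU => absolutelyContinuous_toFinite μ ?_⟩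
  -- `V` attains the supremum of the measures of saturations. Joining `U` to `V` cannot increase it,
  -- so `U` lies in the saturation of `V` up to a null set.
  obtain ⟨Q, hQ, hQV⟩ := exists_isWandering_saturation_eq_iUnion
    (W := fun k => if k = 0 then V else U) (T := T) (fun k => by split_ifs <;> assumption)
  have hVQ : saturation T V ⊆ saturation T Q := by
    rw [hQV]
    exact Set.subset_iUnion_of_subset 0 (by simp)
  have hUQ : U ⊆ saturation T Q := by
    rw [hQV]
    exact Set.subset_iUnion_of_subset 1 (by simpa using subset_saturation T U)
  have hle : m (saturation T Q) ≤ m (saturation T V) := by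
    refine (le_sSup (Set.mem_ofPred_eq ▸ ⟨Q, hQ, rfl⟩ :
      m (saturation T Q) ∈ {c | ∃ W, IsWandering T W ∧ m (saturation T W) = c})).trans
      (le_of_tendsto' hs fun k => ?_)
    rw [← hWs, hVW]
    exact measure_mono (Set.subset_iUnion (fun k => saturation T (W k)) k)
  refine measure_mono_null (Set.sdiff_subset_sdiff_left hUQ) ?_
  rw [measure_sdiff hVQ (measurableSet_saturation T hV.1).nullMeasurableSet (measure_ne_top _ _)]
  exact tsub_eq_zero_of_le hle

theorem IsConservative.conservative {T : X ≃ᵐ X} {μ : Measure X} (h : IsConservative T μ)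
    (hT : μ.map T ≪ μ) : Conservative T μ := by
  refine ⟨⟨T.measurable, hT⟩, fun s hs h0 => ?_⟩
  by_contra! hret
  exact h0 (h s ((isWandering_iff _ _).2 ⟨hs, hret⟩))

end Wandering

/-! ### Products of a measure-preserving or mildly mixing map with a conservative one. -/

section Product

variable {X : Type u} [MeasurableSpace X] {Z : Type v} [MeasurableSpace Z]

theorem iterate_prodCongr (P : X ≃ᵐ X) (R : Z ≃ᵐ Z) (n : ℕ) (p : X × Z) :
    (P.prodCongr R)^[n] p = (P^[n] p.1, R^[n] p.2) := by
  have : ⇑(P.prodCongr R) = Prod.map P R := rfl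
  rw [this, Prod.map_iterate]
  rfl

/-- The product of a transformation preserving a finite measure with a conservative one is
conservative. -/
theorem IsWandering.measure_prod_eq_zero {P : X ≃ᵐ X} {R : Z ≃ᵐ Z} {ν : Measure X}
    [IsFiniteMeasure ν] {m : Measure Z} [SFinite m] (hP : MeasurePreserving P ν ν)
    (hR : Conservative R m) {A : Set (X × Z)} (hA : IsWandering (P.prodCongr R) A) :
    (ν.prod m) A = 0 := by
  rw [isWandering_iff] at hA
  obtain ⟨hAm, hAw⟩ := hA
  rw [Measure.prod_apply_symm hAm, lintegral_eq_zero_iff (measurable_measure_prodMk_right hAm)]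
  -- A section of positive measure recurs with measure bounded below infinitely often. Pulled back
  -- by `P^[n]`, the sections along the orbit of `z` are pairwise disjoint of the same measures,
  -- which is impossible in a finite measure space.
  have hrec : ∀ᵐ z ∂m, ∀ j : ℕ, ((j : ℝ≥0∞) + 1)⁻¹ ≤ ν ((fun x => (x, z)) ⁻¹' A) →
      ∃ᶠ n in atTop, ((j : ℝ≥0∞) + 1)⁻¹ ≤ ν ((fun x => (x, R^[n] z)) ⁻¹' A) := by
    rw [ae_all_iff]
    exact fun j => hR.ae_mem_imp_frequently_image_mem
      (measurable_measure_prodMk_right hAm measurableSet_Ici).nullMeasurableSet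
  filter_upwards [hrec] with z hz
  by_contra h0
  obtain ⟨j, hj⟩ := ENNReal.exists_inv_nat_lt h0
  have hj' : ((j : ℝ≥0∞) + 1)⁻¹ ≤ ν ((fun x => (x, z)) ⁻¹' A) :=
    (ENNReal.inv_le_inv.2 le_self_add).trans hj.le
  have hsec : ∀ n : ℕ, MeasurableSet ((fun x => (x, R^[n] z)) ⁻¹' A) := fun n =>
    measurable_prodMk_right hAm
  have hmeas : ∀ n : ℕ, ν (P^[n] ⁻¹' ((fun x => (x, R^[n] z)) ⁻¹' A)) =
      ν ((fun x => (x, R^[n] z)) ⁻¹' A) := fun n =>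
    (hP.iterate n).measure_preimage (hsec n).nullMeasurableSet
  have hdisj : ∀ k n : ℕ, k < n → Disjoint (P^[k] ⁻¹' ((fun x => (x, R^[k] z)) ⁻¹' A))
      (P^[n] ⁻¹' ((fun x => (x, R^[n] z)) ⁻¹' A)) := by
    intro k n hkn
    refine Set.disjoint_left.2 fun t hk hn => hAw _ hk (n - k) (by omega) ?_
    rw [iterate_prodCongr, ← Function.iterate_add_apply, ← Function.iterate_add_apply,
      Nat.sub_add_cancel hkn.le]
    exact hn
  have hsum : ∑' n : ℕ, ν ((fun x => (x, R^[n] z)) ⁻¹' A) ≠ ∞ := by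
    simp_rw [← hmeas]
    refine ((tsum_measure_le_measure_univ
      (fun n => ((hP.iterate n).measurable (hsec n)).nullMeasurableSet) ?_).trans_lt
        (measure_lt_top ν _)).ne
    intro k n hkn
    rcases hkn.lt_or_gt with h | h
    · exact (hdisj k n h).aedisjoint
    · exact (hdisj n k h).symm.aedisjoint
  have hfin := ENNReal.finite_const_le_of_tsum_ne_top hsum
    (ε := ((j : ℝ≥0∞) + 1)⁻¹) (by simp)
  exact (Nat.frequently_atTop_iff_infinite.1 (hz j hj')) hfin

/-- Along a conservative system, the sections of a measurable set return infinitely often close to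
themselves, in measure. -/
theorem ae_frequently_measure_symmDiff_section_lt [StandardBorelSpace X] {R : Z → Z}
    {ν : Measure X} [IsFiniteMeasure ν] {m : Measure Z} (hR : Conservative R m) {A : Set (X × Z)}
    (hA : MeasurableSet A) :
    ∀ᵐ z ∂m, ∀ j : ℕ, ∃ᶠ n in atTop,
      ν (symmDiff ((fun x => (x, z)) ⁻¹' A) ((fun x => (x, R^[n] z)) ⁻¹' A)) <
        2 * ENNReal.ofReal (1 / (j + 1)) := by
  -- The measure algebra is separable. Recurrence to balls around the countably many sets of `𝒜`
  -- gives recurrence of the section to itself, with the radius doubled.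
  obtain ⟨𝒜, h𝒜c, h𝒜⟩ := exists_countable_measureDense ν
  have hsec : ∀ z : Z, MeasurableSet ((fun x : X => (x, z)) ⁻¹' A) := fun z =>
    measurable_prodMk_right hA
  have hmeas : ∀ s ∈ 𝒜, Measurable fun z => ν (symmDiff ((fun x => (x, z)) ⁻¹' A) s) := by
    intro s hs
    have hs' : MeasurableSet (Prod.fst ⁻¹' s : Set (X × Z)) := measurable_fst (h𝒜.measurable s hs)
    exact measurable_measure_prodMk_right ((hA.diff hs').union (hs'.diff hA))
  have hrec : ∀ᵐ z ∂m, ∀ s ∈ 𝒜, ∀ j : ℕ,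
      ν (symmDiff ((fun x => (x, z)) ⁻¹' A) s) < ENNReal.ofReal (1 / (j + 1)) →
      ∃ᶠ n in atTop, ν (symmDiff ((fun x => (x, R^[n] z)) ⁻¹' A) s) <
        ENNReal.ofReal (1 / (j + 1)) := by
    rw [ae_ball_iff h𝒜c]
    intro s hs
    rw [ae_all_iff]
    exact fun j => hR.ae_mem_imp_frequently_image_mem
      (hmeas s hs measurableSet_Iio).nullMeasurableSet
  filter_upwards [hrec] with z hz j
  obtain ⟨s, hs, hzs⟩ := h𝒜.approx _ (hsec z) (measure_ne_top _ _) (1 / (j + 1)) (by positivity)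
  refine (hz s hs j hzs).mono fun n hn => ?_
  refine (measure_symmDiff_le _ s _).trans_lt ?_
  rw [two_mul, symmDiff_comm s]
  exact ENNReal.add_lt_add hzs hn

/-- A measurable set that is almost rigid for a mildly mixing transformation is null or conull. -/
theorem IsMildlyMixing.measure_eq_zero_or_compl {P : X ≃ᵐ X} {ν : Measure X}
    [IsProbabilityMeasure ν] (hP : IsMildlyMixing P ν) {E : Set X} (hE : MeasurableSet E)
    {k : ℕ → ℕ} (hk : Tendsto k atTop atTop)
    (hrigid : Tendsto (fun i => ν (symmDiff (P^[k i] ⁻¹' E) E)) atTop (𝓝 0)) :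
    ν E = 0 ∨ ν Eᶜ = 0 := by
  obtain ⟨c, hc⟩ := hP.rigid_const (E.indicator 1)
    -- The `L¹` distance between two indicators is the measure of the symmetric difference.
    (memLp_indicator_const ∞ hE 1 (Or.inr (measure_ne_top _ _))) k hk (by
      refine hrigid.congr fun i => ?_
      have hm : MeasurableSet (symmDiff (P^[k i] ⁻¹' E) E) :=
        ((P.measurable.iterate _) hE).symmDiff hE
      have : ∀ x, ‖E.indicator (1 : X → ℝ) (P^[k i] x) - E.indicator (1 : X → ℝ) x‖ₑ =
          (symmDiff (P^[k i] ⁻¹' E) E).indicator (1 : X → ℝ≥0∞) x := by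
        intro x
        by_cases h1 : P^[k i] x ∈ E <;> by_cases h2 : x ∈ E <;>
          simp [Set.indicator, Set.mem_symmDiff, h1, h2]
      rw [eLpNorm_one_eq_lintegral_enorm]
      simp_rw [this]
      rw [lintegral_indicator_one hm])
  by_cases h : c = 1
  · right
    rw [← mem_ae_iff]
    filter_upwards [hc] with x hx
    by_contra hxE
    simp [hxE, h] at hx
  · left
    rw [measure_eq_zero_iff_ae_notMem]
    filter_upwards [hc] with x hx hxE
    simp only [hxE, Set.indicator_of_mem, Pi.one_apply] at hx
    exact h hx.symm

/-- The invariant sets of the product of a mildly mixing transformation and a conservative one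
only depend on the second coordinate. -/
theorem IsMildlyMixing.ae_section_null_or_conull [StandardBorelSpace X] {P : X ≃ᵐ X} {R : Z ≃ᵐ Z}
    {ν : Measure X} [IsProbabilityMeasure ν] {m : Measure Z} (hP : IsMildlyMixing P ν)
    (hR : Conservative R m) {A : Set (X × Z)} (hA : MeasurableSet A)
    (hinv : P.prodCongr R ⁻¹' A = A) :
    ∀ᵐ z ∂m, ν ((fun x => (x, z)) ⁻¹' A) = 0 ∨ ν ((fun x => (x, z)) ⁻¹' A)ᶜ = 0 := by
  filter_upwards [ae_frequently_measure_symmDiff_section_lt (ν := ν) hR hA] with z hz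
  have hsec : ∀ z : Z, MeasurableSet ((fun x : X => (x, z)) ⁻¹' A) := fun z =>
    measurable_prodMk_right hA
  choose k hk hklt using fun j => (frequently_atTop.1 (hz j)) j
  refine hP.measure_eq_zero_or_compl (hsec z) (tendsto_atTop_mono hk tendsto_id) ?_
  -- Invariance of `A` turns closeness of the sections at `z` and `R^[k j] z` into rigidity of the
  -- section at `z` along `k`.
  have hiter : ∀ n : ℕ, P^[n] ⁻¹' ((fun x => (x, R^[n] z)) ⁻¹' A) = (fun x => (x, z)) ⁻¹' A := by
    intro n
    have hn : (P.prodCongr R)^[n] ⁻¹' A = A := by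
      rw [Set.preimage_iterate_eq]
      exact Function.iterate_fixed hinv n
    ext x
    conv_rhs => rw [← hn]
    simp only [Set.mem_preimage, iterate_prodCongr]
  have hz0 : Tendsto (fun j : ℕ => 2 * ENNReal.ofReal (1 / ((j : ℝ) + 1))) atTop (𝓝 0) := by
    have := (ENNReal.tendsto_ofReal tendsto_one_div_add_atTop_nhds_zero_nat)
    simpa using ENNReal.Tendsto.const_mul this (Or.inr (ENNReal.ofNat_ne_top (n := 2)))
  refine tendsto_of_tendsto_of_tendsto_of_le_of_le tendsto_const_nhds hz0 (fun _ => zero_le)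
    fun j => ?_
  have heq : symmDiff (P^[k j] ⁻¹' ((fun x => (x, z)) ⁻¹' A)) ((fun x => (x, z)) ⁻¹' A) =
      P^[k j] ⁻¹' (symmDiff ((fun x => (x, z)) ⁻¹' A) ((fun x => (x, R^[k j] z)) ⁻¹' A)) := by
    rw [Set.preimage_symmDiff, hiter]
  rw [heq, (hP.ergodic.toMeasurePreserving.iterate (k j)).measure_preimage
    ((hsec _).symmDiff (hsec _)).nullMeasurableSet]
  exact (hklt j).le

end Product

/-! ### Kakutani's theorem for infinite product measures. -/

section Kakutani

variable {X : ℕ → Type u} [∀ n, MeasurableSpace (X n)]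

theorem lintegral_infinitePi_prod (b : ∀ n, Measure (X n)) [∀ n, IsProbabilityMeasure (b n)]
    (s : Finset ℕ) {g : ∀ n, X n → ℝ≥0∞} (hg : ∀ n, Measurable (g n)) :
    ∫⁻ x, ∏ i ∈ s, g i (x i) ∂Measure.infinitePi b = ∏ i ∈ s, ∫⁻ t, g i t ∂b i := by
  rw [ProbabilityTheory.lintegral_prod_eq_prod_lintegral_of_indepFun s
    (fun i (x : ∀ n, X n) => g i (x i)) (ProbabilityTheory.iIndepFun_infinitePi hg)
    fun i => (hg i).comp (measurable_pi_apply i)]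
  refine Finset.prod_congr rfl fun i _ => ?_
  exact (measurePreserving_eval_infinitePi b i).lintegral_comp (hg i)

theorem integral_infinitePi_prod (b : ∀ n, Measure (X n)) [∀ n, IsProbabilityMeasure (b n)]
    (s : Finset ℕ) {g : ∀ n, X n → ℝ} (hg : ∀ n, Measurable (g n)) :
    ∫ x, ∏ i ∈ s, g i (x i) ∂Measure.infinitePi b = ∏ i ∈ s, ∫ t, g i t ∂b i := by
  have h := ((ProbabilityTheory.iIndepFun_infinitePi (P := b) hg).precomp
    (Subtype.val_injective (p := fun i => i ∈ s))).integral_fun_prod_eq_prod_integral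
    fun i => ((hg i).comp (measurable_pi_apply _)).aestronglyMeasurable
  simp_rw [← Finset.prod_coe_sort s]
  refine h.trans (Finset.prod_congr rfl fun i _ => ?_)
  exact (integral_map (φ := fun x : ∀ n, X n => x i) (measurable_pi_apply _).aemeasurable
    (hg i).aestronglyMeasurable).symm.trans (by rw [Measure.infinitePi_map_eval])

theorem integrable_infinitePi_prod (b : ∀ n, Measure (X n)) [∀ n, IsProbabilityMeasure (b n)]
    (s : Finset ℕ) {g : ∀ n, X n → ℝ} (hg : ∀ n, Measurable (g n))
    (hgi : ∀ n, Integrable (g n) (b n)) :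
    Integrable (fun x => ∏ i ∈ s, g i (x i)) (Measure.infinitePi b) := by
  refine ⟨(Finset.measurable_prod s fun i _ =>
    (hg i).comp (measurable_pi_apply i)).aestronglyMeasurable, ?_⟩
  have hnorm : ∀ x : ∀ n, X n, ‖∏ i ∈ s, g i (x i)‖ₑ = ∏ i ∈ s, ‖g i (x i)‖ₑ := fun x => by
    simp only [← ofReal_norm, norm_prod]
    exact ENNReal.ofReal_prod_of_nonneg fun i _ => norm_nonneg _
  rw [HasFiniteIntegral]
  simp_rw [hnorm]
  rw [lintegral_infinitePi_prod b s fun i => (hg i).enorm]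
  exact ENNReal.prod_lt_top fun i _ => (hgi i).2

/-- **Kakutani's theorem**, singular case. -/
theorem mutuallySingular_infinitePi {a b : ∀ n, Measure (X n)} [∀ n, IsProbabilityMeasure (a n)]
    [∀ n, IsProbabilityMeasure (b n)] {w : ∀ n, X n → ℝ≥0∞} (hw : ∀ n, Measurable (w n))
    (hwtop : ∀ n x, w n x ≠ ∞) (hab : ∀ n, a n = (b n).withDensity fun x => w n x ^ 2)
    (h : Tendsto (fun N : ℕ => ∏ n ∈ Finset.range N, ∫⁻ x, w n x ∂b n) atTop (𝓝 0)) :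
    Measure.MutuallySingular (Measure.infinitePi a) (Measure.infinitePi b) := by
  have hinv : ∀ n, ∫⁻ x, (w n x)⁻¹ ∂a n = ∫⁻ x, w n x ∂b n := by
    intro n
    have hm : Measurable fun x => (w n x)⁻¹ := (hw n).inv
    rw [hab, lintegral_withDensity_eq_lintegral_mul _ ((hw n).pow_const 2) hm]
    refine lintegral_congr fun x => ?_
    rcases eq_or_ne (w n x) 0 with h0 | h0
    · simp [h0]
    · rw [Pi.mul_apply, sq, mul_assoc, ENNReal.mul_inv_cancel h0 (hwtop n x), mul_one]
  have key : ∀ N : ℕ, ∃ A : Set (∀ n, X n),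
      Measure.infinitePi b A ≤ ∏ n ∈ Finset.range N, ∫⁻ x, w n x ∂b n ∧
      Measure.infinitePi a Aᶜ ≤ ∏ n ∈ Finset.range N, ∫⁻ x, w n x ∂b n := by
    intro N
    -- Markov's inequality for `∏ w` under `b`, and for `∏ w⁻¹` under `a`: both integrals equal, or
    -- are replaced by, the same product of affinities through `hinv`.
    refine ⟨{x | 1 ≤ ∏ n ∈ Finset.range N, w n (x n)}, ?_, ?_⟩
    · rw [← lintegral_infinitePi_prod b _ hw]
      have := mul_meas_ge_le_lintegral (μ := Measure.infinitePi b)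
        (Finset.measurable_prod (Finset.range N) fun i _ =>
          (hw i).comp (measurable_pi_apply (X := X) i)) 1
      simpa using this
    · simp_rw [← hinv]
      rw [← lintegral_infinitePi_prod a _ (g := fun n x => (w n x)⁻¹) fun n => (hw n).inv]
      have := mul_meas_ge_le_lintegral (μ := Measure.infinitePi a)
        (Finset.measurable_prod (Finset.range N) fun i _ =>
          (hw i).inv.comp (measurable_pi_apply (X := X) i)) 1
      rw [one_mul] at this
      refine le_trans (measure_mono fun x hx => ?_) this
      simp only [Set.mem_compl_iff, Set.mem_ofPred_eq, not_le] at hx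
      simp only [Set.mem_ofPred_eq, Function.comp_apply, Pi.inv_apply]
      rw [← ENNReal.prod_inv_distrib fun i _ j _ _ => Or.inr (hwtop j _)]
      exact ENNReal.one_le_inv.2 hx.le
  -- A measure below both has total mass at most twice every partial product, hence vanishes.
  refine Measure.mutuallySingular_of_disjoint fun m hma hmb => ?_
  have hm : m Set.univ = 0 := by
    refine le_antisymm (ge_of_tendsto' (by simpa using h.add h) fun N => ?_) zero_le
    obtain ⟨A, hA, hA'⟩ := key N
    rw [← Set.union_compl_self A]
    exact (measure_union_le _ _).trans (add_le_add ((hmb A).trans hA) ((hma Aᶜ).trans hA'))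
  rw [Measure.measure_univ_eq_zero.1 hm]
  exact bot_le

variable {b : ∀ n, Measure (X n)} [∀ n, IsProbabilityMeasure (b n)] {w : ∀ n, X n → ℝ}

/-- Expanding the square, both squared products integrate to 1. In the cross term the first `N`
factors are squared and integrate to 1, leaving the affinities from `N` to `L`. -/
theorem integral_sq_sub_partial_prod (hw : ∀ n, Measurable (w n))
    (hwL : ∀ n, MemLp (w n) 2 (b n)) (hw1 : ∀ n, ∫ x, w n x ^ 2 ∂b n = 1)
    {N L : ℕ} (hNL : N ≤ L) :
    ∫ x, (∏ k ∈ Finset.range N, w k (x k) - ∏ k ∈ Finset.range L, w k (x k)) ^ 2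
      ∂Measure.infinitePi b = 2 - 2 * ∏ k ∈ Finset.Ico N L, ∫ x, w k x ∂b k := by
  have hw2 : ∀ n, Measurable fun x => w n x ^ 2 := fun n => (hw n).pow_const 2
  have hi2 : ∀ n, Integrable (fun x => w n x ^ 2) (b n) := fun n => (hwL n).integrable_sq
  have hi : ∀ n, Integrable (w n) (b n) := fun n => (hwL n).integrable one_le_two
  set g : ∀ n, X n → ℝ := fun n => if n < N then fun x => w n x ^ 2 else w n
  have hg : ∀ n, Measurable (g n) := fun n => by
    by_cases h : n < N <;> simp only [g, h, if_true, if_false, hw, hw2]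
  have hgi : ∀ n, Integrable (g n) (b n) := fun n => by
    by_cases h : n < N <;> simp only [g, h, if_true, if_false, hi, hi2]
  have hsplit : ∀ x : ∀ n, X n,
      (∏ k ∈ Finset.range N, w k (x k) - ∏ k ∈ Finset.range L, w k (x k)) ^ 2 =
      ∏ k ∈ Finset.range N, w k (x k) ^ 2 + ∏ k ∈ Finset.range L, w k (x k) ^ 2 -
        2 * ∏ k ∈ Finset.range L, g k (x k) := by
    intro x
    have h1 : ∏ k ∈ Finset.range N, g k (x k) = ∏ k ∈ Finset.range N, w k (x k) ^ 2 :=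
      Finset.prod_congr rfl fun k hk => by simp [g, Finset.mem_range.1 hk]
    have h2 : ∏ k ∈ Finset.Ico N L, g k (x k) = ∏ k ∈ Finset.Ico N L, w k (x k) :=
      Finset.prod_congr rfl fun k hk => by simp [g, (Finset.mem_Ico.1 hk).1.not_gt]
    rw [← Finset.prod_range_mul_prod_Ico (fun k => g k (x k)) hNL, h1, h2,
      Finset.prod_pow, Finset.prod_pow,
      ← Finset.prod_range_mul_prod_Ico (fun k => w k (x k)) hNL]
    ring
  simp_rw [hsplit]
  rw [integral_sub (f := fun x : ∀ n, X n => ∏ k ∈ Finset.range N, w k (x k) ^ 2 +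
      ∏ k ∈ Finset.range L, w k (x k) ^ 2) ((integrable_infinitePi_prod b _ hw2 hi2).add
      (integrable_infinitePi_prod b _ hw2 hi2))
      ((integrable_infinitePi_prod b _ hg hgi).const_mul 2),
    integral_add (integrable_infinitePi_prod b _ hw2 hi2) (integrable_infinitePi_prod b _ hw2 hi2),
    integral_const_mul, integral_infinitePi_prod b _ hw2, integral_infinitePi_prod b _ hw2,
    integral_infinitePi_prod b _ hg,
    ← Finset.prod_range_mul_prod_Ico (fun k => ∫ x, g k x ∂b k) hNL]
  have h1 : ∏ k ∈ Finset.range N, ∫ x, g k x ∂b k = 1 :=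
    Finset.prod_eq_one fun k hk => by simp [g, Finset.mem_range.1 hk, hw1]
  have h2 : ∏ k ∈ Finset.Ico N L, ∫ x, g k x ∂b k = ∏ k ∈ Finset.Ico N L, ∫ x, w k x ∂b k :=
    Finset.prod_congr rfl fun k hk => by simp [g, (Finset.mem_Ico.1 hk).1.not_gt]
  rw [h1, h2]
  simp only [hw1, Finset.prod_const_one]
  ring

theorem memLp_two_partial_prod (hw : ∀ n, Measurable (w n)) (hwL : ∀ n, MemLp (w n) 2 (b n))
    (N : ℕ) :
    MemLp (fun x => ∏ k ∈ Finset.range N, w k (x k)) 2 (Measure.infinitePi b) := by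
  have hm : Measurable fun x : ∀ n, X n => ∏ k ∈ Finset.range N, w k (x k) :=
    Finset.measurable_prod _ fun i _ => (hw i).comp (measurable_pi_apply i)
  rw [memLp_two_iff_integrable_sq hm.aestronglyMeasurable]
  simp_rw [← Finset.prod_pow]
  exact integrable_infinitePi_prod b _ (fun n => (hw n).pow_const 2) fun n => (hwL n).integrable_sq

theorem toReal_eLpNorm_two_sq {α : Type*} [MeasurableSpace α] {m : Measure α} {f : α → ℝ}
    (hf : MemLp f 2 m) : (eLpNorm f 2 m).toReal ^ 2 = ∫ x, f x ^ 2 ∂m := by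
  rw [hf.eLpNorm_eq_integral_rpow_norm two_ne_zero ENNReal.ofNat_ne_top, ENNReal.toReal_ofReal
    (by positivity)]
  simp only [ENNReal.toReal_ofNat, Real.rpow_ofNat, Real.norm_eq_abs, sq_abs]
  rw [← Real.rpow_natCast, ← Real.rpow_mul (integral_nonneg fun x => sq_nonneg _)]
  norm_num

/-- The partial products are Cauchy in `L²`: a tail product is a quotient of two partial products of
affinities and tends to `c / c = 1`. This is where `c > 0` is needed. -/
theorem exists_tendsto_eLpNorm_partial_prod (hw : ∀ n, Measurable (w n))
    (hwL : ∀ n, MemLp (w n) 2 (b n)) (hw1 : ∀ n, ∫ x, w n x ^ 2 ∂b n = 1) {c : ℝ} (hc : 0 < c)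
    (h : Tendsto (fun N : ℕ => ∏ n ∈ Finset.range N, ∫ x, w n x ∂b n) atTop (𝓝 c)) :
    ∃ g : (∀ n, X n) → ℝ, MemLp g 2 (Measure.infinitePi b) ∧ Tendsto (fun N : ℕ =>
      eLpNorm ((fun x => ∏ k ∈ Finset.range N, w k (x k)) - g) 2 (Measure.infinitePi b))
      atTop (𝓝 0) := by
  set F : ℕ → Lp ℝ 2 (Measure.infinitePi b) := fun N => (memLp_two_partial_prod hw hwL N).toLp _
  have hnorm : ∀ N L, N ≤ L → dist (F N) (F L) ^ 2 =
      2 - 2 * ∏ k ∈ Finset.Ico N L, ∫ x, w k x ∂b k := by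
    intro N L hNL
    rw [← integral_sq_sub_partial_prod hw hwL hw1 hNL, dist_eq_norm, ← MemLp.toLp_sub,
      Lp.norm_toLp, toReal_eLpNorm_two_sq]
    · rfl
    · exact (memLp_two_partial_prod hw hwL N).sub (memLp_two_partial_prod hw hwL L)
  have hne : ∀ N : ℕ, ∏ n ∈ Finset.range N, ∫ x, w n x ∂b n ≠ 0 := by
    intro N h0
    refine hc.ne' (tendsto_nhds_unique h (tendsto_const_nhds.congr' ?_))
    filter_upwards [eventually_ge_atTop N] with L hL
    rw [← Finset.prod_range_mul_prod_Ico _ hL, h0, zero_mul]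
  have hcauchy : CauchySeq F := by
    rw [Metric.cauchySeq_iff']
    intro ε hε
    have hlim : Tendsto (fun p : ℕ × ℕ => 2 - 2 * ((∏ n ∈ Finset.range p.2, ∫ x, w n x ∂b n) /
        ∏ n ∈ Finset.range p.1, ∫ x, w n x ∂b n)) (atTop ×ˢ atTop) (𝓝 (2 - 2 * (c / c))) :=
      tendsto_const_nhds.sub (tendsto_const_nhds.mul
        ((h.comp tendsto_snd).div (h.comp tendsto_fst) hc.ne'))
    rw [div_self hc.ne', show (2 : ℝ) - 2 * 1 = 0 by norm_num, prod_atTop_atTop_eq] at hlim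
    obtain ⟨⟨N, N'⟩, hN⟩ := eventually_atTop.1 (hlim.eventually_lt_const (pow_pos hε 2))
    refine ⟨max N N', fun n hn => ?_⟩
    rw [dist_comm]
    refine lt_of_pow_lt_pow_left₀ 2 hε.le ?_
    rw [hnorm _ _ hn]
    have := hN (max N N', n) ⟨le_max_left _ _, (le_max_right _ _).trans hn⟩
    dsimp only at this
    rwa [← Finset.prod_range_mul_prod_Ico _ hn, mul_div_cancel_left₀ _ (hne _)] at this
  obtain ⟨G, hG⟩ := cauchySeq_tendsto_of_complete hcauchy
  refine ⟨G, Lp.memLp G, ?_⟩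
  have := (Lp.tendsto_Lp_iff_tendsto_eLpNorm' F G).1 hG
  refine this.congr fun N => eLpNorm_congr_ae ?_
  exact ((memLp_two_partial_prod hw hwL N).coeFn_toLp).sub (ae_eq_refl _)

/-- The indicator of the box splits over the coordinates, so Fubini applies; coordinates outside `s`
contribute total mass 1. The value does not depend on `N`, so it survives the limit. -/
theorem setLIntegral_box_partial_prod {a : ∀ n, Measure (X n)} [∀ n, IsProbabilityMeasure (a n)]
    (hw : ∀ n, Measurable (w n))
    (hab : ∀ n, a n = (b n).withDensity fun x => ‖w n x‖ₑ ^ 2) {s : Finset ℕ}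
    {t : ∀ n, Set (X n)} (ht : ∀ n, MeasurableSet (t n)) {N : ℕ} (hN : s ⊆ Finset.range N) :
    ∫⁻ x in (s : Set ℕ).pi t, ‖∏ k ∈ Finset.range N, w k (x k)‖ₑ ^ 2 ∂Measure.infinitePi b =
      ∏ n ∈ s, a n (t n) := by
  classical
  set t' : ∀ n, Set (X n) := fun n => if n ∈ s then t n else Set.univ
  have ht'm : ∀ n, MeasurableSet (t' n) := fun n => by
    by_cases h : n ∈ s <;> simp [t', h, ht]
  have hmeas : ∀ n, Measurable ((t' n).indicator fun x => ‖w n x‖ₑ ^ 2) := fun n =>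
    ((hw n).enorm.pow_const 2).indicator (ht'm n)
  have hpi : MeasurableSet ((s : Set ℕ).pi t) := .pi (Set.to_countable _) fun n _ => ht n
  rw [← lintegral_indicator hpi]
  have hind : ∀ x : ∀ n, X n, ((s : Set ℕ).pi t).indicator
      (fun x => ‖∏ k ∈ Finset.range N, w k (x k)‖ₑ ^ 2) x =
      ∏ k ∈ Finset.range N, (t' k).indicator (fun x => ‖w k x‖ₑ ^ 2) (x k) := by
    intro x
    by_cases hx : x ∈ (s : Set ℕ).pi t
    · rw [Set.indicator_of_mem hx, ← ofReal_norm, norm_prod,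
        ENNReal.ofReal_prod_of_nonneg fun i _ => norm_nonneg _, ← Finset.prod_pow]
      refine Finset.prod_congr rfl fun k _ => ?_
      rw [Set.indicator_of_mem, ofReal_norm]
      by_cases h : k ∈ s
      · simpa [t', h] using hx k h
      · simp [t', h]
    · rw [Set.indicator_of_notMem hx]
      simp only [Set.mem_pi, not_forall] at hx
      obtain ⟨k, hk, hkx⟩ := hx
      have hkx' : x k ∉ t' k := by simpa [t', Finset.mem_coe.1 hk] using hkx
      exact (Finset.prod_eq_zero (hN hk) (Set.indicator_of_notMem hkx' _)).symm
  simp_rw [hind]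
  rw [lintegral_infinitePi_prod b _ hmeas]
  have hfac : ∀ n, ∫⁻ x, (t' n).indicator (fun x => ‖w n x‖ₑ ^ 2) x ∂b n = a n (t' n) := fun n => by
    rw [lintegral_indicator (ht'm n), hab, withDensity_apply _ (ht'm n)]
  simp_rw [hfac]
  rw [← Finset.prod_subset hN fun n _ hn => by simp [t', hn]]
  exact Finset.prod_congr rfl fun n hn => by simp [t', hn]

/-- **Kakutani's theorem**, absolutely continuous case. -/
theorem absolutelyContinuous_infinitePi {a : ∀ n, Measure (X n)} [∀ n, IsProbabilityMeasure (a n)]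
    (hw : ∀ n, Measurable (w n))
    (hab : ∀ n, a n = (b n).withDensity fun x => ‖w n x‖ₑ ^ 2) {c : ℝ} (hc : 0 < c)
    (h : Tendsto (fun N : ℕ => ∏ n ∈ Finset.range N, ∫ x, w n x ∂b n) atTop (𝓝 c)) :
    Measure.infinitePi a ≪ Measure.infinitePi b := by
  have hlint : ∀ n, ∫⁻ x, ‖w n x‖ₑ ^ 2 ∂b n = 1 := fun n => by
    rw [← setLIntegral_univ, ← withDensity_apply _ .univ, ← hab, measure_univ]
  have hwL : ∀ n, MemLp (w n) 2 (b n) := fun n => by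
    refine ⟨(hw n).aestronglyMeasurable, ?_⟩
    rw [eLpNorm_lt_top_iff_lintegral_rpow_enorm_lt_top two_ne_zero ENNReal.ofNat_ne_top]
    simp [hlint]
  have hw1 : ∀ n, ∫ x, w n x ^ 2 ∂b n = 1 := fun n => by
    rw [integral_eq_lintegral_of_nonneg_ae (Eventually.of_forall fun x => sq_nonneg _)
      ((hw n).pow_const 2).aestronglyMeasurable, ← ENNReal.toReal_one, ← hlint n]
    congr 1
    refine lintegral_congr fun x => ?_
    rw [← enorm_pow, Real.enorm_of_nonneg (sq_nonneg _)]
  obtain ⟨g, hg, hlim⟩ := exists_tendsto_eLpNorm_partial_prod hw hwL hw1 hc h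
  -- The square of the `L²` limit is the density. It suffices to compare on boxes, where the
  -- integrals of the squared partial products converge and are eventually constant.
  suffices (Measure.infinitePi b).withDensity (fun x => ‖g x‖ₑ ^ 2) = Measure.infinitePi a from
    this ▸ withDensity_absolutelyContinuous _ _
  refine Measure.eq_infinitePi _ fun s t ht => ?_
  have hpi : MeasurableSet ((s : Set ℕ).pi t) := .pi (Set.to_countable _) fun n _ => ht n
  rw [withDensity_apply _ hpi]
  have hsq : ∀ f : (∀ n, X n) → ℝ, ∫⁻ x in (s : Set ℕ).pi t, ‖f x‖ₑ ^ 2 ∂Measure.infinitePi b =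
      eLpNorm f 2 ((Measure.infinitePi b).restrict ((s : Set ℕ).pi t)) ^ 2 := fun f => by
    have := eLpNorm_nnreal_pow_eq_lintegral (f := f) (p := 2)
      (μ := (Measure.infinitePi b).restrict ((s : Set ℕ).pi t)) two_ne_zero
    simpa using this.symm
  have hconv : Tendsto (fun N : ℕ => eLpNorm (fun x => ∏ k ∈ Finset.range N, w k (x k)) 2
      ((Measure.infinitePi b).restrict ((s : Set ℕ).pi t))) atTop
      (𝓝 (eLpNorm g 2 ((Measure.infinitePi b).restrict ((s : Set ℕ).pi t)))) := by
    set r := (Measure.infinitePi b).restrict ((s : Set ℕ).pi t)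
    have hr : ∀ N, MemLp (fun x => ∏ k ∈ Finset.range N, w k (x k)) 2 r := fun N =>
      (memLp_two_partial_prod hw hwL N).restrict _
    have hgr : MemLp g 2 r := hg.restrict _
    have h0 : Tendsto (fun N : ℕ => eLpNorm ((fun x => ∏ k ∈ Finset.range N, w k (x k)) - g) 2 r)
        atTop (𝓝 0) :=
      tendsto_of_tendsto_of_tendsto_of_le_of_le tendsto_const_nhds hlim (fun _ => zero_le)
        fun N => eLpNorm_mono_measure _ Measure.restrict_le_self
    have := ((Lp.tendsto_Lp_iff_tendsto_eLpNorm'' _ hr g hgr).2 h0).norm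
    simp only [Lp.norm_toLp] at this
    exact (ENNReal.tendsto_toReal_iff (fun N => (hr N).eLpNorm_ne_top) hgr.eLpNorm_ne_top).1 this
  refine tendsto_nhds_unique (l := atTop) (f := fun N : ℕ =>
    ∫⁻ x in (s : Set ℕ).pi t, ‖∏ k ∈ Finset.range N, w k (x k)‖ₑ ^ 2 ∂Measure.infinitePi b) ?_
    (tendsto_const_nhds.congr' ?_)
  · rw [hsq]
    simp_rw [hsq]
    exact ENNReal.Tendsto.pow hconv
  · obtain ⟨N, hN⟩ := s.exists_nat_subset_range
    filter_upwards [eventually_ge_atTop N] with L hL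
    exact (setLIntegral_box_partial_prod hw hab ht
      (hN.trans (Finset.range_subset_range.2 hL))).symm

end Kakutani

/-! ### Densities and affinities of measures given relative to a common measure. -/

section Density

variable {X : Type u} [MeasurableSpace X]

theorem measurable_density (μ ν : Measure X) : Measurable (density μ ν) :=
  (Measure.measurable_rnDeriv μ ν).ennreal_toReal

theorem density_nonneg (μ ν : Measure X) (x : X) : 0 ≤ density μ ν x := ENNReal.toReal_nonneg

theorem withDensity_density {μ ν : Measure X} [IsProbabilityMeasure μ] [IsProbabilityMeasure ν]
    (h : μ ≪ ν) : ν.withDensity (fun x => ENNReal.ofReal (density μ ν x)) = μ := by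
  conv_rhs => rw [← Measure.withDensity_rnDeriv_eq μ ν h]
  refine withDensity_congr_ae ?_
  filter_upwards [Measure.rnDeriv_lt_top μ ν] with x hx
  exact ENNReal.ofReal_toReal hx.ne

theorem density_pos {μ ν : Measure X} [IsProbabilityMeasure μ] [IsProbabilityMeasure ν]
    (h : ν ≪ μ) : ∀ᵐ x ∂ν, 0 < density μ ν x := by
  filter_upwards [Measure.rnDeriv_lt_top μ ν, Measure.rnDeriv_pos' h] with x hx hx'
  exact ENNReal.toReal_pos hx'.ne' hx.ne

/-- Since `T` preserves `ν`, transporting `μ` by `T` only composes its density with `T⁻¹`. -/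
theorem withDensity_density_symm {T : X ≃ᵐ X} {μ ν : Measure X} [IsProbabilityMeasure μ]
    [IsProbabilityMeasure ν] (h : μ ≪ ν) (hT : MeasurePreserving T ν ν) :
    ν.withDensity (fun x => ENNReal.ofReal (density μ ν (T.symm x))) = μ.map T := by
  ext s hs
  rw [withDensity_apply _ hs, Measure.map_apply T.measurable hs]
  conv_rhs => rw [← withDensity_density h, withDensity_apply _ (T.measurable hs)]
  rw [← hT.setLIntegral_comp_preimage hs]
  · simp
  · exact ((measurable_density μ ν).comp T.symm.measurable).ennreal_ofReal

/-- The density of one measure with respect to another one, both given by densities with respect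
to a common measure. -/
theorem withDensity_eq_withDensity_sqrt_div {ν : Measure X} {p q : X → ℝ} (hp : Measurable p)
    (hq : Measurable q) (hp0 : ∀ x, 0 ≤ p x) (hq0 : ∀ᵐ x ∂ν, 0 < q x) :
    ν.withDensity (fun x => ENNReal.ofReal (p x)) =
      (ν.withDensity fun x => ENNReal.ofReal (q x)).withDensity fun x => ‖√(p x / q x)‖ₑ ^ 2 := by
  have hm : Measurable fun x => ‖√(p x / q x)‖ₑ ^ 2 := (hp.div hq).sqrt.enorm.pow_const 2
  rw [← withDensity_mul _ hq.ennreal_ofReal hm]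
  refine withDensity_congr_ae ?_
  filter_upwards [hq0] with x hx
  rw [Pi.mul_apply, ← enorm_pow, Real.sq_sqrt (div_nonneg (hp0 x) hx.le),
    Real.enorm_of_nonneg (div_nonneg (hp0 x) hx.le), ← ENNReal.ofReal_mul hx.le,
    mul_div_cancel₀ _ hx.ne']

/-- The affinity is independent of the reference measure, because `q √(p / q) = √(p q)` where `q >
0`. -/
theorem integral_sqrt_div_withDensity {ν : Measure X} {p q : X → ℝ} (hq : Measurable q)
    (hq0 : ∀ᵐ x ∂ν, 0 < q x) :
    ∫ x, √(p x / q x) ∂(ν.withDensity fun x => ENNReal.ofReal (q x)) = ∫ x, √(p x * q x) ∂ν := by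
  rw [integral_withDensity_eq_integral_toReal_smul hq.ennreal_ofReal (by simp)]
  refine integral_congr_ae ?_
  filter_upwards [hq0] with x hx
  rw [ENNReal.toReal_ofReal hx.le, smul_eq_mul]
  conv_rhs => rw [show p x * q x = q x ^ 2 * (p x / q x) by field_simp,
    Real.sqrt_mul (sq_nonneg _), Real.sqrt_sq hx.le]

end Density

/-! ### Nonsingularity of the product map, and singularity of `μ` and `ν`. -/

section ProductNonsingular

variable {X : ℕ → Type u} [∀ n, MeasurableSpace (X n)]

/-- Infinite products of measures with everywhere positive densities and positive affinity. -/
theorem absolutelyContinuous_infinitePi_of_density {ν a b : ∀ n, Measure (X n)}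
    [∀ n, IsProbabilityMeasure (a n)] [∀ n, IsProbabilityMeasure (b n)] {p q : ∀ n, X n → ℝ}
    (hp : ∀ n, Measurable (p n)) (hq : ∀ n, Measurable (q n)) (hp0 : ∀ n x, 0 ≤ p n x)
    (hq0 : ∀ n, ∀ᵐ x ∂ν n, 0 < q n x)
    (ha : ∀ n, (ν n).withDensity (fun x => ENNReal.ofReal (p n x)) = a n)
    (hb : ∀ n, (ν n).withDensity (fun x => ENNReal.ofReal (q n x)) = b n) {c : ℝ} (hc : 0 < c)
    (h : Tendsto (fun N : ℕ => ∏ n ∈ Finset.range N, ∫ x, √(p n x * q n x) ∂ν n) atTop (𝓝 c)) :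
    Measure.infinitePi a ≪ Measure.infinitePi b := by
  refine absolutelyContinuous_infinitePi (w := fun n x => √(p n x / q n x))
    (fun n => ((hp n).div (hq n)).sqrt) (fun n => ?_) hc (h.congr fun N => ?_)
  · rw [← ha, ← hb, withDensity_eq_withDensity_sqrt_div (hp n) (hq n) (hp0 n) (hq0 n)]
  · refine Finset.prod_congr rfl fun n _ => ?_
    rw [← hb, integral_sqrt_div_withDensity (hq n) (hq0 n)]

variable {T : ∀ n, X n ≃ᵐ X n} {ν μ : ∀ n, Measure (X n)}
    [∀ n, IsProbabilityMeasure (ν n)] [∀ n, IsProbabilityMeasure (μ n)]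

/-- The image of `μ` is again a product measure, with densities `φ_n ∘ T_n⁻¹`. The affinity is
symmetric in the two measures, so one hypothesis gives absolute continuity both ways. -/
theorem isNonsingular_productMap (hT : ∀ n, MeasurePreserving (T n) (ν n) (ν n))
    (hμν : ∀ n, μ n ≪ ν n) (hνμ : ∀ n, ν n ≪ μ n)
    (hpos : ∃ c : ℝ, 0 < c ∧ Tendsto
      (fun N : ℕ => ∏ n ∈ Finset.range N,
        ∫ x, √(density (μ n) (ν n) x * density (μ n) (ν n) ((T n).symm x)) ∂(ν n))
      atTop (𝓝 c)) :
    IsNonsingular (productMap T) (Measure.infinitePi μ) := by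
  obtain ⟨c, hc, h⟩ := hpos
  have hmap : (Measure.infinitePi μ).map (productMap T) =
      Measure.infinitePi fun n => (μ n).map (T n) :=
    Measure.infinitePi_map_pi μ fun n => (T n).measurable
  have : ∀ n, IsProbabilityMeasure ((μ n).map (T n)) := fun n =>
    Measure.isProbabilityMeasure_map (T n).measurable.aemeasurable
  have hd := fun n => measurable_density (μ n) (ν n)
  have hd' := fun n => (hd n).comp (T n).symm.measurable
  have hd0 := fun n => density_pos (hνμ n)
  have hd0' : ∀ n, ∀ᵐ x ∂ν n, 0 < density (μ n) (ν n) ((T n).symm x) := fun n =>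
    ((hT n).symm (T n)).quasiMeasurePreserving.ae (hd0 n)
  rw [IsNonsingular, hmap]
  constructor
  · refine absolutelyContinuous_infinitePi_of_density hd' hd (fun n x => density_nonneg _ _ _) hd0
      (fun n => withDensity_density_symm (hμν n) (hT n)) (fun n => withDensity_density (hμν n)) hc
      (h.congr fun N => Finset.prod_congr rfl fun n _ => ?_)
    exact integral_congr_ae (.of_forall fun x => by simp only [Function.comp_apply, mul_comm])
  · exact absolutelyContinuous_infinitePi_of_density hd hd' (fun n x => density_nonneg _ _ _) hd0'
      (fun n => withDensity_density (hμν n)) (fun n => withDensity_density_symm (hμν n) (hT n)) hc h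

theorem mutuallySingular_infinitePi_of_density (hμν : ∀ n, μ n ≪ ν n)
    (hzero : Tendsto
      (fun N : ℕ => ∏ n ∈ Finset.range N, ∫ x, √(density (μ n) (ν n) x) ∂(ν n))
      atTop (𝓝 0)) :
    Measure.MutuallySingular (Measure.infinitePi μ) (Measure.infinitePi ν) := by
  have hint : ∀ n, Integrable (fun x => √(density (μ n) (ν n) x)) (ν n) := fun n => by
    refine MemLp.integrable (q := 2) one_le_two ?_
    rw [memLp_two_iff_integrable_sq (measurable_density _ _).sqrt.aestronglyMeasurable]
    simp_rw [Real.sq_sqrt (density_nonneg _ _ _)]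
    exact Measure.integrable_toReal_rnDeriv
  refine mutuallySingular_infinitePi (w := fun n x => ENNReal.ofReal √(density (μ n) (ν n) x))
    (fun n => (measurable_density _ _).sqrt.ennreal_ofReal) (fun n x => ENNReal.ofReal_ne_top)
    (fun n => ?_) ?_
  · conv_lhs => rw [← withDensity_density (hμν n)]
    congr with x
    rw [← ENNReal.ofReal_pow (Real.sqrt_nonneg _), Real.sq_sqrt (density_nonneg _ _ _)]
  · rw [← ENNReal.ofReal_zero]
    refine (ENNReal.tendsto_ofReal hzero).congr fun N => ?_
    rw [ENNReal.ofReal_prod_of_nonneg fun n _ => integral_nonneg fun x => Real.sqrt_nonneg _]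
    exact Finset.prod_congr rfl fun n _ => ofReal_integral_eq_lintegral_ofReal (hint n)
      (Eventually.of_forall fun x => Real.sqrt_nonneg _)

end ProductNonsingular

/-! ### Resampling one coordinate, and sets that depend on no coordinate. -/

section UpdateCoordinate

/-- Replace the `n`-th coordinate of a point of a product space. -/
def updateCoord {X : ℕ → Type u} (Y : Type v) (n : ℕ) (p : X n × (∀ k, X k) × Y) :
    (∀ k, X k) × Y :=
  (Function.update p.2.1 n p.1, p.2.2)

theorem updateCoord_updateCoord {X : ℕ → Type u} {Y : Type v} (n : ℕ) (s t : X n)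
    (z : (∀ k, X k) × Y) :
    updateCoord Y n (s, updateCoord Y n (t, z)) = updateCoord Y n (s, z) := by
  simp [updateCoord]

variable {X : ℕ → Type u} [∀ n, MeasurableSpace (X n)] {Y : Type v} [MeasurableSpace Y]

theorem measurable_update_uncurry (n : ℕ) :
    Measurable fun p : X n × (∀ k, X k) => Function.update p.2 n p.1 := by
  refine measurable_pi_iff.2 fun k => ?_
  rcases eq_or_ne k n with rfl | h
  · simpa using measurable_fst
  · simpa [h] using! (measurable_pi_apply k).comp measurable_snd

/-- Since the product map acts coordinatewise, resampling is a factor map, through which invariant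
and wandering sets pull back. -/
theorem updateCoord_map (T : ∀ n, X n ≃ᵐ X n) (S : Y ≃ᵐ Y) (n : ℕ) (p : X n × (∀ k, X k) × Y) :
    updateCoord Y n ((T n).prodCongr ((productMap T).prodCongr S) p) =
      (productMap T).prodCongr S (updateCoord Y n p) := by
  refine Prod.ext (funext fun k => ?_) rfl
  change Function.update (fun k => T k (p.2.1 k)) n (T n p.1) k =
    T k (Function.update p.2.1 n p.1 k)
  rcases eq_or_ne k n with rfl | h
  · simp
  · simp [h]

variable (μ : ∀ n, Measure (X n)) [∀ n, IsProbabilityMeasure (μ n)] (κ : Measure Y) [SFinite κ]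

theorem measurePreserving_update (n : ℕ) :
    MeasurePreserving (fun p : X n × (∀ k, X k) => Function.update p.2 n p.1)
      ((μ n).prod (Measure.infinitePi μ)) (Measure.infinitePi μ) := by
  classical
  refine ⟨measurable_update_uncurry n, Measure.eq_infinitePi _ fun s t ht => ?_⟩
  rw [Measure.map_apply (measurable_update_uncurry n) (.pi (Set.to_countable _) fun k _ => ht k)]
  have hpre : (fun p : X n × (∀ k, X k) => Function.update p.2 n p.1) ⁻¹' (s : Set ℕ).pi t =
      (if n ∈ s then t n else Set.univ) ×ˢ ((s.erase n : Finset ℕ) : Set ℕ).pi t := by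
    ext p
    simp only [Set.mem_preimage, Set.mem_pi, Finset.mem_coe, Set.mem_prod, Finset.mem_erase]
    constructor
    · intro h
      refine ⟨?_, fun k hk => by simpa [hk.1] using h k hk.2⟩
      split_ifs with hn
      · simpa using h n hn
      · trivial
    · rintro ⟨h, h'⟩ k hk
      rcases eq_or_ne k n with rfl | hkn
      · simpa [hk] using h
      · simpa [hkn] using h' k ⟨hkn, hk⟩
  rw [hpre, Measure.prod_prod, Measure.infinitePi_pi μ fun i _ => ht i]
  split_ifs with hn
  · exact Finset.mul_prod_erase s (fun i => μ i (t i)) hn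
  · rw [measure_univ, one_mul, Finset.erase_eq_of_notMem hn]

theorem measurePreserving_updateCoord (n : ℕ) :
    MeasurePreserving (updateCoord Y n) ((μ n).prod ((Measure.infinitePi μ).prod κ))
      ((Measure.infinitePi μ).prod κ) :=
  ((measurePreserving_update μ n).prod (MeasurePreserving.id κ)).comp
    ((measurePreserving_prodAssoc (μ n) (Measure.infinitePi μ) κ).symm MeasurableEquiv.prodAssoc)

/-- **Zero-one law**: a set that depends on no coordinate, up to null sets, is null or conull. -/
theorem infinitePi_eq_zero_or_compl_eq_zero {E : Set (∀ n, X n)} (hE : MeasurableSet E)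
    (h : ∀ n, ∀ᵐ p ∂(μ n).prod (Measure.infinitePi μ), Function.update p.2 n p.1 ∈ E ↔ p.2 ∈ E) :
    Measure.infinitePi μ E = 0 ∨ Measure.infinitePi μ Eᶜ = 0 := by
  classical
  rcases eq_or_ne (Measure.infinitePi μ E) 0 with h0 | h0
  · exact Or.inl h0
  right
  -- `E` is independent of every box: resampling splits off one coordinate at a time. Hence the
  -- measure conditioned on `E` is the whole measure, and `E` is conull.
  have key : ∀ (s : Finset ℕ) (t : ∀ n, Set (X n)), (∀ n, MeasurableSet (t n)) →
      Measure.infinitePi μ (E ∩ (s : Set ℕ).pi t) =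
        Measure.infinitePi μ E * ∏ n ∈ s, μ n (t n) := by
    intro s t ht
    induction s using Finset.induction_on with
    | empty => simp
    | insert n s hn ih =>
      have hm : ∀ s : Finset ℕ, MeasurableSet (E ∩ (s : Set ℕ).pi t) := fun s =>
        hE.inter (.pi (Set.to_countable _) fun k _ => ht k)
      rw [← (measurePreserving_update μ n).measure_preimage (hm _).nullMeasurableSet,
        Finset.prod_insert hn, mul_left_comm, ← ih, ← Measure.prod_prod]
      refine measure_congr ?_
      filter_upwards [h n] with p hp
      refine propext ?_
      change Function.update p.2 n p.1 ∈ E ∩ _ ↔ p.1 ∈ t n ∧ p.2 ∈ E ∩ _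
      rw [Set.mem_inter_iff, hp, Set.mem_inter_iff, and_left_comm]
      refine and_congr_right fun _ => ?_
      simp only [Finset.coe_insert, Set.insert_pi, Set.mem_inter_iff, Set.mem_preimage,
        Function.eval, Function.update_self]
      refine and_congr_right fun _ => forall₂_congr fun k hk => ?_
      rw [Function.update_of_ne (ne_of_mem_of_not_mem hk hn)]
  have heq : (Measure.infinitePi μ E)⁻¹ • (Measure.infinitePi μ).restrict E =
      Measure.infinitePi μ := by
    refine Measure.eq_infinitePi _ fun s t ht => ?_
    rw [Measure.smul_apply, Measure.restrict_apply (.pi (Set.to_countable _) fun k _ => ht k),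
      Set.inter_comm, key s t ht, smul_eq_mul, ← mul_assoc,
      ENNReal.inv_mul_cancel h0 (measure_ne_top _ _), one_mul]
  rw [← heq, Measure.smul_apply, Measure.restrict_apply hE.compl]
  simp

variable {μ κ}

/-- If almost all the sections of a set along a coordinate are null or conull, then the set does not
depend on that coordinate. -/
theorem ae_updateCoord_mem_iff {A : Set ((∀ n, X n) × Y)} (hA : MeasurableSet A) {n : ℕ}
    (h : ∀ᵐ z ∂(Measure.infinitePi μ).prod κ, (∀ᵐ t ∂μ n, updateCoord Y n (t, z) ∉ A) ∨
      ∀ᵐ t ∂μ n, updateCoord Y n (t, z) ∈ A) :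
    ∀ᵐ p ∂(μ n).prod ((Measure.infinitePi μ).prod κ), updateCoord Y n p ∈ A ↔ p.2 ∈ A := by
  have hmp := measurePreserving_updateCoord μ κ n
  -- `G` is a version of `A` that is exactly, not just almost everywhere, insensitive to the `n`-th
  -- coordinate; it agrees with `A` almost everywhere because resampling preserves the measure.
  set G : Set ((∀ n, X n) × Y) := {z | ∀ᵐ t ∂μ n, updateCoord Y n (t, z) ∈ A}
  have hG : MeasurableSet G :=
    measurable_measure_prodMk_right (μ := μ n) (hmp.measurable hA).compl
      (measurableSet_singleton 0)
  have hGinv : ∀ p, updateCoord Y n p ∈ G ↔ p.2 ∈ G := fun p => by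
    change (∀ᵐ t ∂μ n, updateCoord Y n (t, updateCoord Y n (p.1, p.2)) ∈ A) ↔ _
    simp_rw [updateCoord_updateCoord]
    rfl
  have hpG : ∀ᵐ p ∂(μ n).prod ((Measure.infinitePi μ).prod κ), updateCoord Y n p ∈ A ↔ p.2 ∈ G := by
    have hswap : ∀ᵐ q ∂((Measure.infinitePi μ).prod κ).prod (μ n),
        updateCoord Y n q.swap ∈ A ↔ q.1 ∈ G := by
      have hm : MeasurableSet {q : ((∀ n, X n) × Y) × X n | updateCoord Y n q.swap ∈ A ↔ q.1 ∈ G} :=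
        ((hmp.measurable.comp measurable_swap) hA).iff (measurable_fst hG)
      rw [Measure.ae_prod_iff_ae_ae hm]
      filter_upwards [h] with z hz
      by_cases hzG : z ∈ G
      · have hz' : ∀ᵐ t ∂μ n, updateCoord Y n (t, z) ∈ A := hzG
        filter_upwards [hz'] with t ht
        exact iff_of_true ht hzG
      · filter_upwards [hz.resolve_right hzG] with t ht
        exact iff_of_false ht hzG
    exact (Measure.measurePreserving_swap (μ := μ n)
      (ν := (Measure.infinitePi μ).prod κ)).quasiMeasurePreserving.ae hswap
  have hAG : ∀ᵐ z ∂(Measure.infinitePi μ).prod κ, z ∈ A ↔ z ∈ G := by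
    have hm : MeasurableSet {z | z ∈ A ↔ z ∈ G} := hA.iff hG
    rw [← hmp.map_eq, ae_map_iff hmp.measurable.aemeasurable hm]
    filter_upwards [hpG] with p hp
    rw [hp, hGinv]
  filter_upwards [hpG, Measure.quasiMeasurePreserving_snd.ae hAG] with p hp hp'
  rw [hp, hp']

/-- An invariant set of `T × S`, almost all the sections of which along each coordinate of the
product space are null or conull, is null or conull if `S` is ergodic. -/
theorem measure_prod_eq_zero_or_compl {T : ∀ n, X n ≃ᵐ X n} {S : Y ≃ᵐ Y}
    (hT : IsNonsingular (productMap T) (Measure.infinitePi μ)) (hS : PreErgodic S κ)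
    {A : Set ((∀ n, X n) × Y)} (hA : MeasurableSet A)
    (hinv : (productMap T).prodCongr S ⁻¹' A = A)
    (h : ∀ n, ∀ᵐ z ∂(Measure.infinitePi μ).prod κ, (∀ᵐ t ∂μ n, updateCoord Y n (t, z) ∉ A) ∨
      ∀ᵐ t ∂μ n, updateCoord Y n (t, z) ∈ A) :
    (Measure.infinitePi μ).prod κ A = 0 ∨ (Measure.infinitePi μ).prod κ Aᶜ = 0 := by
  have hsec : ∀ᵐ y ∂κ, ∀ n, ∀ᵐ p ∂(μ n).prod (Measure.infinitePi μ),
      (Function.update p.2 n p.1, y) ∈ A ↔ (p.2, y) ∈ A := by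
    refine ae_all_iff.2 fun n => ?_
    have h1 := (measurePreserving_prodAssoc (μ n)
      (Measure.infinitePi μ) κ).quasiMeasurePreserving.ae (ae_updateCoord_mem_iff hA (h n))
    have h2 := (Measure.measurePreserving_swap (μ := κ)
      (ν := (μ n).prod (Measure.infinitePi μ))).quasiMeasurePreserving.ae h1
    exact Measure.ae_ae_of_ae_prod h2
  have h01 : ∀ᵐ y ∂κ, Measure.infinitePi μ ((fun x => (x, y)) ⁻¹' A) = 0 ∨
      Measure.infinitePi μ ((fun x => (x, y)) ⁻¹' Aᶜ) = 0 := by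
    filter_upwards [hsec] with y hy
    exact infinitePi_eq_zero_or_compl_eq_zero μ (measurable_prodMk_right hA) hy
  -- `B` is strictly `S`-invariant: the sections of `Aᶜ` at `y` and `S y` correspond under `T`, and
  -- nonsingularity preserves null sets.
  set B : Set Y := {y | Measure.infinitePi μ ((fun x => (x, y)) ⁻¹' Aᶜ) = 0}
  have hB : MeasurableSet B :=
    measurable_measure_prodMk_right hA.compl (measurableSet_singleton 0)
  have hBinv : S ⁻¹' B = B := by
    ext y
    have hpre : (fun x => (x, y)) ⁻¹' Aᶜ =
        productMap T ⁻¹' ((fun x => (x, S y)) ⁻¹' Aᶜ) := by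
      conv_lhs => rw [← hinv]
      rfl
    change Measure.infinitePi μ ((fun x => (x, S y)) ⁻¹' Aᶜ) = 0 ↔
      Measure.infinitePi μ ((fun x => (x, y)) ⁻¹' Aᶜ) = 0
    rw [hpre, ← (productMap T).map_apply]
    exact ⟨fun h => hT.1 h, fun h => hT.2 h⟩
  rcases hS.measure_self_or_compl_eq_zero hB hBinv with h0 | h0
  · left
    rw [Measure.prod_apply_symm hA, lintegral_eq_zero_iff (measurable_measure_prodMk_right hA)]
    filter_upwards [h01, measure_eq_zero_iff_ae_notMem.1 h0] with y hy hyB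
    exact hy.resolve_right hyB
  · right
    rw [Measure.prod_apply_symm hA.compl,
      lintegral_eq_zero_iff (measurable_measure_prodMk_right hA.compl)]
    filter_upwards [mem_ae_iff.2 h0] with y hy
    exact hy

/-! ### Conservativity, ergodicity and the dichotomy for `T × S`. -/

variable {T : ∀ n, X n ≃ᵐ X n} {S : Y ≃ᵐ Y} {ν : ∀ n, Measure (X n)}
  [∀ n, IsProbabilityMeasure (ν n)]

theorem ae_section_null_or_conull_of_invariant [∀ n, StandardBorelSpace (X n)]
    (hmix : ∀ n, IsMildlyMixing (T n) (ν n)) (hμν : ∀ n, μ n ≪ ν n)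
    (hTS : Conservative ((productMap T).prodCongr S) ((Measure.infinitePi μ).prod κ))
    {A : Set ((∀ n, X n) × Y)} (hA : MeasurableSet A)
    (hinv : (productMap T).prodCongr S ⁻¹' A = A) (n : ℕ) :
    ∀ᵐ z ∂(Measure.infinitePi μ).prod κ, (∀ᵐ t ∂μ n, updateCoord Y n (t, z) ∉ A) ∨
      ∀ᵐ t ∂μ n, updateCoord Y n (t, z) ∈ A := by
  have hinv' : (T n).prodCongr ((productMap T).prodCongr S) ⁻¹' (updateCoord Y n ⁻¹' A) =
      updateCoord Y n ⁻¹' A := by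
    ext p
    rw [Set.mem_preimage, Set.mem_preimage, updateCoord_map]
    exact Set.ext_iff.1 hinv _
  filter_upwards [(hmix n).ae_section_null_or_conull hTS
    ((measurePreserving_updateCoord μ κ n).measurable hA) hinv'] with z hz
  refine hz.imp (fun h => ?_) fun h => ?_
  · exact (hμν n).ae_le (measure_eq_zero_iff_ae_notMem.1 h)
  · exact (hμν n).ae_le (mem_ae_iff.2 h)

/-- The saturation of a maximal wandering set of `T × S` depends on no coordinate. -/
theorem ae_section_null_or_conull_of_maximal (hT : ∀ n, MeasurePreserving (T n) (ν n) (ν n))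
    (hμν : ∀ n, μ n ≪ ν n)
    (hns : ((Measure.infinitePi μ).prod κ).map ((productMap T).prodCongr S) ≪
      (Measure.infinitePi μ).prod κ) {W : Set ((∀ n, X n) × Y)}
    (hW : IsWandering ((productMap T).prodCongr S) W)
    (hmax : ∀ V, IsWandering ((productMap T).prodCongr S) V →
      (Measure.infinitePi μ).prod κ (V \ saturation ((productMap T).prodCongr S) W) = 0) (n : ℕ) :
    ∀ᵐ z ∂(Measure.infinitePi μ).prod κ,
      (∀ᵐ t ∂μ n, updateCoord Y n (t, z) ∉ saturation ((productMap T).prodCongr S) W) ∨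
      ∀ᵐ t ∂μ n, updateCoord Y n (t, z) ∈ saturation ((productMap T).prodCongr S) W := by
  set R := (productMap T).prodCongr S
  set m := (Measure.infinitePi μ).prod κ
  set D := saturation R W
  have hmp : MeasurePreserving (updateCoord Y n) ((μ n).prod m) m :=
    measurePreserving_updateCoord μ κ n
  have hD : MeasurableSet D := measurableSet_saturation R hW.1
  have hquasi : Measure.QuasiMeasurePreserving R m m := ⟨R.measurable, hns⟩
  have hcons : Conservative R (m.restrict Dᶜ) := by
    refine IsConservative.conservative (fun V hV => ?_) ?_
    · rw [Measure.restrict_apply hV.1]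
      exact hmax V hV
    · have hmaps : Set.MapsTo R Dᶜ Dᶜ := fun z hz => (apply_mem_saturation_iff R W z).not.2 hz
      exact (hquasi.restrict hmaps).absolutelyContinuous
  have hiter : ∀ (k : ℕ) (p : X n × (∀ k, X k) × Y),
      updateCoord Y n (((T n).prodCongr R)^[k] p) = R^[k] (updateCoord Y n p) := fun k =>
    (Function.Semiconj.iterate_right (f := updateCoord Y n) (updateCoord_map T S n) k)
  have hpull : ∀ V, IsWandering R V → IsWandering ((T n).prodCongr R) (updateCoord Y n ⁻¹' V) := by
    intro V hV
    rw [isWandering_iff] at hV ⊢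
    refine ⟨hmp.measurable hV.1, fun p hp k hk hp' => hV.2 _ hp k hk ?_⟩
    rwa [Set.mem_preimage, hiter] at hp'
  -- The pullback of a wandering set is wandering for `T_n × R`, which is conservative over `Dᶜ` as
  -- `T_n` preserves the finite measure `ν_n`.
  have hnull : ∀ k : ℤ, ∀ᵐ z ∂m.restrict Dᶜ, ∀ᵐ t ∂ν n,
      updateCoord Y n (t, z) ∉ zpowMap R k ⁻¹' W := by
    intro k
    have h0 := (hpull _ (hW.preimage_zpowMap k)).measure_prod_eq_zero (hT n) hcons
    have hm : MeasurableSet (updateCoord Y n ⁻¹' (zpowMap R k ⁻¹' W)) :=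
      hmp.measurable (hW.preimage_zpowMap k).1
    rw [Measure.prod_apply_symm hm,
      lintegral_eq_zero_iff (measurable_measure_prodMk_right hm)] at h0
    filter_upwards [h0] with z hz
    exact measure_eq_zero_iff_ae_notMem.1 hz
  have hnull' : ∀ᵐ z ∂m, z ∉ D → ∀ᵐ t ∂μ n, updateCoord Y n (t, z) ∉ D := by
    have := (ae_restrict_iff' hD.compl).1 (ae_all_iff.2 hnull)
    filter_upwards [this] with z hz hzD
    filter_upwards [(hμν n).ae_le (ae_all_iff.2 (hz hzD))] with t ht
    rintro ⟨k, hk⟩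
    exact ht k hk
  have hswap := (Measure.measurePreserving_swap (μ := m) (ν := μ n)).quasiMeasurePreserving.ae
    (hmp.quasiMeasurePreserving.ae hnull')
  filter_upwards [Measure.ae_ae_of_ae_prod hswap] with z hz
  by_cases h : ∀ᵐ t ∂μ n, updateCoord Y n (t, z) ∈ D
  · exact Or.inr h
  · left
    -- One resampled point outside `D` suffices: resampling it again forgets `t`, so almost every
    -- resampling of `z` lies outside `D`.
    obtain ⟨t, ht, htD⟩ := (hz.and_frequently (not_eventually.1 h)).exists
    have := ht htD
    simpa [Prod.swap, updateCoord_updateCoord] using this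

theorem preErgodic_prod [∀ n, StandardBorelSpace (X n)]
    (hmix : ∀ n, IsMildlyMixing (T n) (ν n)) (hμν : ∀ n, μ n ≪ ν n)
    (hT : IsNonsingular (productMap T) (Measure.infinitePi μ)) (hS : PreErgodic S κ)
    (hTS : Conservative ((productMap T).prodCongr S) ((Measure.infinitePi μ).prod κ)) :
    PreErgodic ((productMap T).prodCongr S) ((Measure.infinitePi μ).prod κ) := by
  refine ⟨fun A hA hinv => eventuallyConst_set'.2 ?_⟩
  simpa using measure_prod_eq_zero_or_compl hT hS hA hinv
    (ae_section_null_or_conull_of_invariant hmix hμν hTS hA hinv)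

theorem map_prodCongr_absolutelyContinuous
    (hT : IsNonsingular (productMap T) (Measure.infinitePi μ)) (hS : IsNonsingular S κ) :
    ((Measure.infinitePi μ).prod κ).map ((productMap T).prodCongr S) ≪
      (Measure.infinitePi μ).prod κ := by
  have : ((Measure.infinitePi μ).prod κ).map ((productMap T).prodCongr S) =
      ((Measure.infinitePi μ).map (productMap T)).prod (κ.map S) :=
    (Measure.map_prod_map _ _ (productMap T).measurable S.measurable).symm
  rw [this]
  exact hT.1.prod hS.1

theorem isTotallyDissipative_or_preErgodic_prod [∀ n, StandardBorelSpace (X n)]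
    (hmix : ∀ n, IsMildlyMixing (T n) (ν n)) (hμν : ∀ n, μ n ≪ ν n)
    (hT : IsNonsingular (productMap T) (Measure.infinitePi μ)) (hS : IsNonsingular S κ)
    (hSe : PreErgodic S κ) :
    IsTotallyDissipative ((productMap T).prodCongr S) ((Measure.infinitePi μ).prod κ) ∨
      PreErgodic ((productMap T).prodCongr S) ((Measure.infinitePi μ).prod κ) := by
  have hns := map_prodCongr_absolutelyContinuous hT hS
  obtain ⟨W, hW, hmax⟩ := exists_isWandering_maximal ((productMap T).prodCongr S)
    ((Measure.infinitePi μ).prod κ)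
  rcases measure_prod_eq_zero_or_compl hT hSe (measurableSet_saturation _ hW.1)
    (Set.ext fun z => apply_mem_saturation_iff _ W z) (ae_section_null_or_conull_of_maximal
      (fun n => (hmix n).ergodic.toMeasurePreserving) hμν hns hW hmax) with h0 | h0
  · right
    refine preErgodic_prod hmix hμν hT hSe (IsConservative.conservative (fun V hV => ?_) hns)
    refine measure_mono_null ?_ (measure_union_null (hmax V hV) h0)
    rw [Set.sdiff_union_self]
    exact Set.subset_union_left
  · left
    exact ⟨W, hW, by rwa [iUnion_image_zpow]⟩

/-- This is the case of `S` acting on a single point. -/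
theorem preErgodic_productMap [∀ n, StandardBorelSpace (X n)]
    (hmix : ∀ n, IsMildlyMixing (T n) (ν n)) (hμν : ∀ n, μ n ≪ ν n)
    (hT : IsNonsingular (productMap T) (Measure.infinitePi μ))
    (hcons : IsConservative (productMap T) (Measure.infinitePi μ)) :
    PreErgodic (productMap T) (Measure.infinitePi μ) := by
  have hdirac : PreErgodic (MeasurableEquiv.refl PUnit.{1}) (Measure.dirac PUnit.unit) := by
    refine ⟨fun s _ _ => eventuallyConst_set'.2 ?_⟩
    rcases s.eq_empty_or_nonempty with rfl | h
    · exact Or.inl (ae_eq_refl _)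
    · exact Or.inr (Subsingleton.eq_univ_of_nonempty h ▸ ae_eq_refl _)
  have hid : IsNonsingular (MeasurableEquiv.refl PUnit.{1}) (Measure.dirac PUnit.unit) := by
    have hmap : (Measure.dirac PUnit.unit).map (MeasurableEquiv.refl PUnit.{1}) =
        Measure.dirac PUnit.unit := Measure.map_id
    rw [IsNonsingular, hmap]
    exact ⟨.rfl, .rfl⟩
  have hmp : MeasurePreserving (Prod.fst : (∀ n, X n) × PUnit.{1} → ∀ n, X n)
      ((Measure.infinitePi μ).prod (Measure.dirac PUnit.unit)) (Measure.infinitePi μ) :=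
    measurePreserving_fst
  refine hmp.preErgodic_of_preErgodic_semiconj (preErgodic_prod hmix hμν hT hdirac
    (IsConservative.conservative (fun V hV => ?_) (map_prodCongr_absolutelyContinuous hT hid)))
    fun _ => rfl
  have hW : IsWandering (productMap T) ((fun x => (x, PUnit.unit)) ⁻¹' V) := by
    rw [isWandering_iff] at hV ⊢
    refine ⟨measurable_prodMk_right hV.1, fun x hx k hk hx' => hV.2 _ hx k hk ?_⟩
    rw [iterate_prodCongr]
    exact hx'
  have : V = Prod.fst ⁻¹' ((fun x => (x, PUnit.unit)) ⁻¹' V) := rfl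
  rw [this, hmp.measure_preimage hW.1.nullMeasurableSet]
  exact hcons _ hW

end UpdateCoordinate

theorem proposition2p3 {X : ℕ → Type u} [∀ n, MeasurableSpace (X n)]
    [∀ n, StandardBorelSpace (X n)]
    (T : ∀ n, X n ≃ᵐ X n)
    (ν μ : ∀ n, Measure (X n))
    [∀ n, IsProbabilityMeasure (ν n)] [∀ n, IsProbabilityMeasure (μ n)]
    (hmix : ∀ n, IsMildlyMixing (T n) (ν n))
    (hμν : ∀ n, μ n ≪ ν n) (hνμ : ∀ n, ν n ≪ μ n)
    (hpos : ∃ c : ℝ, 0 < c ∧ Tendsto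
      (fun N : ℕ => ∏ n ∈ Finset.range N,
        ∫ x, √(density (μ n) (ν n) x * density (μ n) (ν n) ((T n).symm x)) ∂(ν n))
      atTop (𝓝 c))
    (hzero : Tendsto
      (fun N : ℕ => ∏ n ∈ Finset.range N, ∫ x, √(density (μ n) (ν n) x) ∂(ν n))
      atTop (𝓝 0))
    (hcons : IsConservative (productMap T) (Measure.infinitePi μ)) :
    IsSharplyWeakMixing.{u, v} (productMap T) (Measure.infinitePi μ) ∧
      Measure.MutuallySingular (Measure.infinitePi μ) (Measure.infinitePi ν) := by
  have hT := isNonsingular_productMap (fun n => (hmix n).ergodic.toMeasurePreserving) hμν hνμ hpos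
  refine ⟨⟨⟨hT, preErgodic_productMap hmix hμν hT hcons, hcons⟩, fun Y _ _ κ _ S hS => ?_⟩,
    mutuallySingular_infinitePi_of_density hμν hzero⟩
  exact isTotallyDissipative_or_preErgodic_prod hmix hμν hT hS.nonsingular hS.ergodic
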